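/- Let $V$ be a real vector space of finite dimension $d$ with dual space $W$, and let $P_0\subset V$ be a full-dimensional (not necessarily simple) polytope, given by a system $\langle \mathbf a_i,\mathbf x\rangle\le b_{0,i}$, $1\le i\le m$, with $\mathbf a_i\in W$, whose inequalities define pairwise distinct facets $F_i=\{\mathbf x\in P_0:\langle \mathbf a_i,\mathbf x\rangle=b_{0,i}\}$. For $F=F_i$ write $\mathbf a_F=\mathbf a_i$ and $b_F=b_i$. The deformation cone $\operatorname{Def}(P_0)$ is the set of all $\mathbf b\in\mathbb R^m$ such that $Q=\{\mathbf x\in V:\langle \mathbf a_i,\mathbf x\rangle\le b_i,\ 1\le i\le m\}$ is a polytope and, for every vertex $v$ of $P_0$, the intersection of the hyperplanes $\{\mathbf x:\langle \mathbf a_i,\mathbf x\rangle=b_i\}$ over all $i$ with $v\in F_i$ is a single point that is a vertex of $Q$. A facet containing a vertex $v$ is called a supporting facet of $v$. For each vertex $v$ of $P_0$ select $d$ supporting facets of $v$ with linearly independent normal vectors; the other supporting facets of $v$ are called extra. Such a selection exists. For example, one can run through the supporting facets of $v$ in the given order and keep a facet if its normal vector is not a linear combination of the normal vectors of the supporting facets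 before it; if the first $d$ supporting facets have linearly independent normal vectors, this selects exactly them. For $\mathbf b\in\mathbb R^m$ let $v_{\mathbf b}$ be the intersection of the hyperplanes $\{\mathbf x:\langle \mathbf a_F,\mathbf x\rangle=b_F\}$ over the $d$ selected facets $F$ of $v$; it is a single point, and it depends linearly on $\mathbf b$. For a vertex $v$ and a facet $F$ consider $$E_{v,F}(\mathbf b):\ \langle \mathbf a_F,v_{\mathbf b}\rangle=b_F,\qquad I_{v,F}(\mathbf b):\ \langle \mathbf a_F,v_{\mathbf b}\rangle\le b_F .$$ Call $(v,F)$ a neighboring pair if $v\notin F$ but there is a vertex $v'\in F$ such that $\{v,v'\}$ is an edge of $P_0$. Then, for every such selection and every $\mathbf b\in\mathbb R^m$, the following are equivalent: 1. $\mathbf b\in\operatorname{Def}(P_0)$. 2. (i) $E_{v,F}(\mathbf b)$ holds for every vertex $v$ and every extra supporting facet $F$ of $v$, and (ii) $I_{v,F}(\mathbf b)$ holds for every vertex $v$ and every facet $F$ with $v\notin F$. 3. (i) holds, and $I_{v,F}(\mathbf b)$ holds for every neighboring pair $(v,F)$. 4. (i) holds, and for every edge $e=\{v,v'\}$ of $P_0$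 there is a real number $\lambda_e\ge 0$ with $v_{\mathbf b}-v'_{\mathbf b}=\lambda_e\,(v-v')$. Moreover, $\operatorname{Def}(P_0)$ is a polyhedral cone, that is, the solution set in $\mathbb R^m$ of finitely many homogeneous linear inequalities. -/

import Mathlib

/-! Deformations of a full-dimensional polytope in a finite-dimensional real vector space `V`.
Normal vectors of facets live in the dual space `Module.Dual ℝ V`, paired by evaluation. -/

namespace PolytopeDeformation

noncomputable section

variable {V : Type*} [AddCommGroup V] [Module ℝ V] {m : ℕ}

/-- The solution set of the system `⟨aᵢ, x⟩ ≤ bᵢ`, `1 ≤ i ≤ m`. -/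
def solutionSet (a : Fin m → Module.Dual ℝ V) (b : Fin m → ℝ) : Set V :=
  {x | ∀ i, a i x ≤ b i}

/-- A polyhedron is the solution set of finitely many linear inequalities. -/
def IsPolyhedron (P : Set V) : Prop :=
  ∃ (k : ℕ) (c : Fin k → Module.Dual ℝ V) (b : Fin k → ℝ), P = solutionSet c b

/-- A polytope is a bounded polyhedron. As `V` carries no norm, boundedness is expressed by
requiring that every linear functional is bounded (above, hence also below) on `P`; for a
finite-dimensional `V` this is boundedness in any norm. -/
def IsPolytope (P : Set V) : Prop :=
  IsPolyhedron P ∧ ∀ l : Module.Dual ℝ V, BddAbove (l '' P)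

/-- Faces of a convex set: its convex extreme subsets. The vertices of `P`, its
zero-dimensional faces, are its extreme points `P.extremePoints ℝ`. -/
def IsFace (P F : Set V) : Prop :=
  Convex ℝ F ∧ IsExtreme ℝ P F

/-- A facet of a full-dimensional polytope in `V`: a nonempty face of dimension `dim V - 1`. -/
def IsFacet (P F : Set V) : Prop :=
  IsFace P F ∧ F.Nonempty ∧ Module.finrank ℝ (vectorSpan ℝ F) + 1 = Module.finrank ℝ V

/-- `{v, v'}` is an edge of `P`: the points are distinct and the segment joining them is a face
(so that both points are vertices of `P`). -/
def IsEdge (P : Set V) (v v' : V) : Prop :=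
  v ≠ v' ∧ IsFace P (segment ℝ v v')

/-- The subset `Fᵢ` of `P₀ = solutionSet a b₀` on which the `i`-th inequality is an equality. -/
def facet (a : Fin m → Module.Dual ℝ V) (b₀ : Fin m → ℝ) (i : Fin m) : Set V :=
  {x | x ∈ solutionSet a b₀ ∧ a i x = b₀ i}

/-- The system `⟨aᵢ, x⟩ ≤ b₀ᵢ` defines a full-dimensional polytope, and its inequalities define
pairwise different facets. -/
structure IsFacetSystem (a : Fin m → Module.Dual ℝ V) (b₀ : Fin m → ℝ) : Prop where
  isPolytope : IsPolytope (solutionSet a b₀)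
  fullDimensional : affineSpan ℝ (solutionSet a b₀) = ⊤
  isFacet : ∀ i, IsFacet (solutionSet a b₀) (facet a b₀ i)
  injective : Function.Injective (facet a b₀)

/-- The vertices of `P₀ = solutionSet a b₀`. -/
def vertices (a : Fin m → Module.Dual ℝ V) (b₀ : Fin m → ℝ) : Set V :=
  (solutionSet a b₀).extremePoints ℝ

/-- The (indices of the) supporting facets of `v`: the facets on which `v` lies. -/
def supporting (a : Fin m → Module.Dual ℝ V) (b₀ : Fin m → ℝ) (v : V) : Set (Fin m) :=
  {i | v ∈ facet a b₀ i}

/-- The intersection of the hyperplanes `⟨aᵢ, x⟩ = bᵢ`, `i ∈ s`. -/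
def hyperplaneInter (a : Fin m → Module.Dual ℝ V) (s : Set (Fin m)) (b : Fin m → ℝ) : Set V :=
  {x | ∀ i ∈ s, a i x = b i}

/-- `Q` is a deformation of `P₀ = solutionSet a b₀` with deforming vector `b`. -/
def IsDeformationWith (a : Fin m → Module.Dual ℝ V) (b₀ : Fin m → ℝ) (Q : Set V)
    (b : Fin m → ℝ) : Prop :=
  IsPolytope Q ∧ Q = solutionSet a b ∧
    ∀ v ∈ vertices a b₀, ∃ u ∈ Q.extremePoints ℝ,
      hyperplaneInter a (supporting a b₀ v) b = {u}

/-- The deformation cone of `P₀ = solutionSet a b₀`: the set of all deforming vectors. -/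
def deformationCone (a : Fin m → Module.Dual ℝ V) (b₀ : Fin m → ℝ) : Set (Fin m → ℝ) :=
  {b | ∃ Q, IsDeformationWith a b₀ Q b}

/-- `σ` selects, for every vertex `v` of `P₀`, exactly `d = dim V` supporting facets of `v` whose
normal vectors are linearly independent. -/
def IsSelection (a : Fin m → Module.Dual ℝ V) (b₀ : Fin m → ℝ) (σ : V → Set (Fin m)) : Prop :=
  ∀ v ∈ vertices a b₀, σ v ⊆ supporting a b₀ v ∧ (σ v).ncard = Module.finrank ℝ V ∧
    LinearIndependent ℝ (fun i : σ v => a i)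

/-- The first `d` linearly independent supporting facets of `v`: run through the supporting facets
in the given order and keep a facet if its normal vector is not a linear combination of the normal
vectors of the supporting facets before it. -/
def firstSupporting (a : Fin m → Module.Dual ℝ V) (b₀ : Fin m → ℝ) (v : V) : Set (Fin m) :=
  {i | i ∈ supporting a b₀ v ∧
    a i ∉ Submodule.span ℝ (a '' {j | j ∈ supporting a b₀ v ∧ j < i})}

open Classical in
/-- The common point of the hyperplanes `⟨aᵢ, x⟩ = bᵢ`, `i ∈ s` (any one if there are several, and
`0` if there is none). With `s = σ v` for a selection `σ` this is the point `v_b`. -/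
def meetingPoint (a : Fin m → Module.Dual ℝ V) (s : Set (Fin m)) (b : Fin m → ℝ) : V :=
  if h : (hyperplaneInter a s b).Nonempty then h.choose else 0

/-- The equality `E_{v,F}(b)` for `F = Fᵢ`, that is `⟨aᵢ, v_b⟩ = bᵢ`. -/
def EqCond (a : Fin m → Module.Dual ℝ V) (σ : V → Set (Fin m)) (b : Fin m → ℝ)
    (v : V) (i : Fin m) : Prop :=
  a i (meetingPoint a (σ v) b) = b i

/-- The inequality `I_{v,F}(b)` for `F = Fᵢ`, that is `⟨aᵢ, v_b⟩ ≤ bᵢ`. -/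
def IneqCond (a : Fin m → Module.Dual ℝ V) (σ : V → Set (Fin m)) (b : Fin m → ℝ)
    (v : V) (i : Fin m) : Prop :=
  a i (meetingPoint a (σ v) b) ≤ b i

/-- All equalities `E_{v,F}(b)` for extra supporting facets `F` of vertices `v`, i.e. for the
supporting facets that are not selected. -/
def ExtraEqualities (a : Fin m → Module.Dual ℝ V) (b₀ : Fin m → ℝ) (σ : V → Set (Fin m))
    (b : Fin m → ℝ) : Prop :=
  ∀ v ∈ vertices a b₀, ∀ i ∈ supporting a b₀ v, i ∉ σ v → EqCond a σ b v i

/-- `Fᵢ` is a neighbor of `v`: `v` does not lie on it, but some vertex joined to `v` by an edge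
does. -/
def IsNeighbor (a : Fin m → Module.Dual ℝ V) (b₀ : Fin m → ℝ) (v : V) (i : Fin m) : Prop :=
  v ∉ facet a b₀ i ∧ ∃ v' ∈ facet a b₀ i, IsEdge (solutionSet a b₀) v v'

end

end PolytopeDeformation

open PolytopeDeformation

open PolytopeDeformation

namespace PolytopeDeformation

open Filter Topology

/-! ### Vertices, edges and boundedness of solution sets. -/

section Polyhedra

variable {V : Type*} [AddCommGroup V] [Module ℝ V] {m : ℕ}

/-! A feasible point is a vertex exactly when its active normals have no common nonzero kernel
vector (`mem_extremePoints_solutionSet_iff`). Under (i) every constraint active at `v` is active at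
`v_b`, so `v_b` is a vertex of `Q` as soon as it lies in `Q`, which is (ii). Boundedness of `Q` is
automatic: a strict solution of the original system lets a shrunken copy of `Q` fit into `P₀`. This
gives 1 ⇔ 2, and 2 → 3 is a weakening.

For 3 → 4, the difference `v_b - v'_b` is killed by the normals of all facets containing the edge,
hence is a multiple of `v - v'`; a facet through `v'` but not `v` fixes the sign.

The substance is 4 → 2, a simplex-method argument. Among the vertices violating the inequality of
`Fᵢ`, take one with `aᵢ` maximal. It is not on `Fᵢ`, so some edge increases `aᵢ`
(`exists_improving_edge`); its other end satisfies the inequality, and the edge condition carries it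
back. The improving edge comes from an extreme ray of the cone of feasible directions at the vertex.

Polyhedrality follows from 1 ⇔ 2, since `v_b` is linear in `b` and there are finitely many vertices.
-/

theorem convex_solutionSet (a : Fin m → Module.Dual ℝ V) (b : Fin m → ℝ) :
    Convex ℝ (solutionSet a b) := by
  intro x hx y hy s t hs ht hst i
  have h1 := mul_le_mul_of_nonneg_left (hx i) hs
  have h2 := mul_le_mul_of_nonneg_left (hy i) ht
  simp only [map_add, map_smul, smul_eq_mul]
  have : b i = s * b i + t * b i := by rw [← add_mul, hst, one_mul]
  linarith

/-- A direction that does not increase the active constraints is feasible. -/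
theorem eventually_add_smul_mem {a : Fin m → Module.Dual ℝ V} {b : Fin m → ℝ} {x y : V}
    (hx : x ∈ solutionSet a b) (hy : ∀ i, a i x = b i → a i y ≤ 0) :
    ∀ᶠ ε in 𝓝[>] (0 : ℝ), x + ε • y ∈ solutionSet a b := by
  refine (eventually_all.2 fun i => ?_ : ∀ᶠ ε in 𝓝[>] (0 : ℝ), ∀ i, a i (x + ε • y) ≤ b i)
  simp only [map_add, map_smul, smul_eq_mul]
  rcases (hx i).eq_or_lt with h | h
  · filter_upwards [self_mem_nhdsWithin] with ε hε
    have := mul_nonpos_of_nonneg_of_nonpos (le_of_lt hε) (hy i h)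
    linarith
  · have hc : Tendsto (fun ε : ℝ => a i x + ε * a i y) (𝓝[>] 0) (𝓝 (a i x + 0 * a i y)) :=
      ((by fun_prop : Continuous fun ε : ℝ => a i x + ε * a i y).tendsto 0).mono_left
        nhdsWithin_le_nhds
    rw [zero_mul, add_zero] at hc
    filter_upwards [hc.eventually_lt_const h] with ε hε using hε.le

theorem exists_add_sub_smul_mem {a : Fin m → Module.Dual ℝ V} {b : Fin m → ℝ} {x y : V}
    (hx : x ∈ solutionSet a b) (hy : ∀ i, a i x = b i → a i y = 0) :
    ∃ ε : ℝ, 0 < ε ∧ x + ε • y ∈ solutionSet a b ∧ x - ε • y ∈ solutionSet a b := by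
  have h1 := eventually_add_smul_mem hx fun i hi => (hy i hi).le
  have h2 := eventually_add_smul_mem (y := -y) hx fun i hi => by simp [hy i hi]
  obtain ⟨ε, ⟨h1, h2⟩, h3⟩ := ((h1.and h2).and self_mem_nhdsWithin).exists
  exact ⟨ε, h3, h1, by simpa [sub_eq_add_neg] using h2⟩

theorem mem_openSegment_add_sub (x y : V) : x ∈ openSegment ℝ (x + y) (x - y) := by
  refine ⟨1 / 2, 1 / 2, by norm_num, by norm_num, by norm_num, ?_⟩
  module

/-- Equality in constraints at a point in an open segment forces equality at the end points. -/
theorem isExtreme_solutionSet_inter (a : Fin m → Module.Dual ℝ V) (b : Fin m → ℝ)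
    (s : Set (Fin m)) :
    IsExtreme ℝ (solutionSet a b) (solutionSet a b ∩ hyperplaneInter a s b) := by
  refine ⟨Set.inter_subset_left, ?_⟩
  rintro x hx y hy z ⟨-, hz⟩ ⟨p, q, hp, hq, hpq, rfl⟩
  refine ⟨hx, fun i hi => le_antisymm (hx i) ?_⟩
  have h := hz i hi
  simp only [map_add, map_smul, smul_eq_mul] at h
  have h2 := mul_le_mul_of_nonneg_left (hy i) hq.le
  have : b i = p * b i + q * b i := by rw [← add_mul, hpq, one_mul]
  exact le_of_mul_le_mul_left (by linarith) hp

theorem mem_extremePoints_solutionSet_iff {a : Fin m → Module.Dual ℝ V} {b : Fin m → ℝ} {v : V} :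
    v ∈ (solutionSet a b).extremePoints ℝ ↔
      v ∈ solutionSet a b ∧ ∀ y, (∀ i, a i v = b i → a i y = 0) → y = 0 := by
  constructor
  · intro hv
    refine ⟨hv.1, fun y hy => ?_⟩
    obtain ⟨ε, hε, h1, h2⟩ := exists_add_sub_smul_mem hv.1 hy
    have := hv.2 h1 h2 (mem_openSegment_add_sub _ _)
    simpa [hε.ne'] using this
  · rintro ⟨hv, h⟩
    refine ⟨hv, fun x hx y hy hxy => ?_⟩
    have := (isExtreme_solutionSet_inter a b {i | a i v = b i}).2 hx hy ⟨hv, fun i hi => hi⟩ hxy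
    rw [← sub_eq_zero]
    refine h _ fun i hi => ?_
    rw [map_sub, this.2 i hi, hi, sub_self]

theorem mem_supporting_iff {a : Fin m → Module.Dual ℝ V} {b : Fin m → ℝ} {v : V}
    (hv : v ∈ solutionSet a b) {i : Fin m} : i ∈ supporting a b v ↔ a i v = b i :=
  ⟨fun h => h.2, fun h => ⟨hv, h⟩⟩

/-- The normals active at the vertex `v` all kill `w - v`. Hence a vertex is determined by its
active set, which gives finiteness of the vertex set. -/
theorem eq_of_supporting_subset {a : Fin m → Module.Dual ℝ V} {b : Fin m → ℝ} {v w : V}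
    (hv : v ∈ vertices a b) (h : supporting a b v ⊆ supporting a b w) : w = v := by
  obtain ⟨hv, h0⟩ := mem_extremePoints_solutionSet_iff.1 hv
  rw [← sub_eq_zero]
  refine h0 _ fun i hi => ?_
  rw [map_sub, hi, (h ((mem_supporting_iff hv).2 hi)).2, sub_self]

theorem finite_vertices (a : Fin m → Module.Dual ℝ V) (b : Fin m → ℝ) :
    (vertices a b).Finite :=
  Set.Finite.of_injOn (f := supporting a b) (t := Set.univ) (fun _ _ => Set.mem_univ _)
    (fun _ hv _ _ h => (eq_of_supporting_subset hv h.le).symm) Set.finite_univ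

/-- Moving along `y` from a feasible point until the first constraint becomes tight. -/
theorem exists_first_tight (a : Fin m → Module.Dual ℝ V) (b : Fin m → ℝ) {s : Set (Fin m)}
    {x y : V} (hx : ∀ i ∈ s, a i x ≤ b i) (hy : ∃ i ∈ s, 0 < a i y) :
    ∃ t : ℝ, 0 ≤ t ∧ (∀ i ∈ s, a i (x + t • y) ≤ b i) ∧
      ∃ i ∈ s, 0 < a i y ∧ a i (x + t • y) = b i := by
  obtain ⟨i, ⟨his, hi⟩, hmin⟩ := Set.exists_min_image {i | i ∈ s ∧ 0 < a i y}
    (fun i => (b i - a i x) / a i y) (Set.toFinite _) hy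
  have h0 : 0 ≤ (b i - a i x) / a i y := div_nonneg (sub_nonneg.2 (hx i his)) hi.le
  refine ⟨_, h0, fun j hj => ?_, i, his, hi, ?_⟩
  · simp only [map_add, map_smul, smul_eq_mul]
    rcases le_or_gt (a j y) 0 with h | h
    · have := mul_nonpos_of_nonneg_of_nonpos h0 h
      linarith [hx j hj]
    · have := (le_div_iff₀ h).1 (hmin j ⟨hj, h⟩)
      linarith
  · simp only [map_add, map_smul, smul_eq_mul]
    rw [div_mul_cancel₀ _ hi.ne']
    ring

/-- If a linear functional is positive somewhere on a pointed polyhedral cone, then it is positive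
on an extreme ray. -/
theorem exists_extreme_ray (a : Fin m → Module.Dual ℝ V) {s : Set (Fin m)}
    (hs : ∀ y, (∀ i ∈ s, a i y = 0) → y = 0) (l : Module.Dual ℝ V) {x : V}
    (hx : ∀ i ∈ s, a i x ≤ 0) (hl : 0 < l x) :
    ∃ r, (∀ i ∈ s, a i r ≤ 0) ∧ 0 < l r ∧
      ∀ y, (∀ i ∈ s, a i r = 0 → a i y = 0) → ∃ c : ℝ, y = c • r := by
  -- Induction on the number of slack constraints: if `x` does not yet span an extreme ray, it is
  -- moved inside its face, keeping `l` fixed, until one more constraint is tight.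
  induction hn : {i | i ∈ s ∧ a i x < 0}.ncard using Nat.strong_induction_on generalizing x with
  | _ n ih =>
  by_cases hray : ∀ y, (∀ i ∈ s, a i x = 0 → a i y = 0) → ∃ c : ℝ, y = c • x
  · exact ⟨x, hx, hl, hray⟩
  push Not at hray
  obtain ⟨y, hy, hyx⟩ := hray
  obtain ⟨z, hz, hlz, hpos⟩ : ∃ z, (∀ i ∈ s, a i x = 0 → a i z = 0) ∧ l z = 0 ∧
      ∃ i ∈ s, 0 < a i z := by
    -- Subtracting this multiple of `x` makes `l` vanish without leaving the face. The result is
    -- nonzero, so by pointedness some constraint sees it, and a sign change makes that value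
    -- positive.
    have hz : ∀ i ∈ s, a i x = 0 → a i (y - (l y / l x) • x) = 0 := fun i hi h => by
      simp [h, hy i hi h]
    have hlz : l (y - (l y / l x) • x) = 0 := by
      simp [div_mul_cancel₀ _ hl.ne']
    have hne : ¬ ∀ i ∈ s, a i (y - (l y / l x) • x) = 0 := fun h =>
      hyx _ (sub_eq_zero.1 (hs _ h))
    push Not at hne
    obtain ⟨i, hi, h⟩ := hne
    rcases h.lt_or_gt with h | h
    · refine ⟨-(y - (l y / l x) • x), fun i hi h => ?_, ?_, i, hi, ?_⟩
      · rw [map_neg, hz i hi h, neg_zero]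
      · rw [map_neg, hlz, neg_zero]
      · rw [map_neg]
        exact neg_pos.2 h
    · exact ⟨_, hz, hlz, i, hi, h⟩
  obtain ⟨t, -, hfeas, i, his, hi, htight⟩ := exists_first_tight a 0 hx hpos
  refine ih _ ?_ hfeas (x := x + t • z) (by simpa [hlz] using hl) rfl
  rw [← hn]
  refine Set.ncard_lt_ncard ⟨?_, fun h => ?_⟩ (Set.toFinite _)
  · rintro j ⟨hj, hlt⟩
    refine ⟨hj, (hx j hj).lt_of_ne fun h => ?_⟩
    simp [h, hz j hj h] at hlt
  · have hi' : a i x < 0 := (hx i his).lt_of_ne fun h => hi.ne' (hz i his h)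
    exact (h ⟨his, hi'⟩).2.ne htight

/-! ### Edges and how to find them. -/

theorem IsEdge.extremePoints {P : Set V} {v v' : V} (h : IsEdge P v v') :
    v ∈ P.extremePoints ℝ ∧ v' ∈ P.extremePoints ℝ := by
  have key : ∀ v v' : V, IsEdge P v v' → v ∈ P.extremePoints ℝ := by
    intro v v' h
    refine h.2.2.extremePoints_subset_extremePoints ?_
    have hne : v' - v ≠ 0 := sub_ne_zero.2 h.1.symm
    refine ⟨left_mem_segment _ _ _, ?_⟩
    rw [segment_eq_image']
    rintro _ ⟨p, ⟨hp, -⟩, rfl⟩ _ ⟨q, ⟨hq, -⟩, rfl⟩ ⟨α, β, hα, hβ, hαβ, e⟩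
    have e2 : (α * p + β * q) • (v' - v) = 0 := by
      have : α • (v + p • (v' - v)) + β • (v + q • (v' - v))
          = (α + β) • v + (α * p + β * q) • (v' - v) := by module
      rw [this, hαβ, one_smul] at e
      simpa using e
    have e3 := (smul_eq_zero.1 e2).resolve_right hne
    have : α * p = 0 := by nlinarith [mul_nonneg hα.le hp, mul_nonneg hβ.le hq]
    have : p = 0 := (mul_eq_zero.1 this).resolve_left hα.ne'
    simp [this]
  refine ⟨key _ _ h, key v' v ⟨h.1.symm, ?_⟩⟩
  rw [segment_symm]
  exact h.2

/-- The facets containing both ends of an edge cut out the line spanned by the edge. -/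
theorem IsEdge.exists_eq_smul {a : Fin m → Module.Dual ℝ V} {b : Fin m → ℝ} {v v' : V}
    (h : IsEdge (solutionSet a b) v v') {y : V}
    (hy : ∀ i, a i v = b i → a i v' = b i → a i y = 0) : ∃ c : ℝ, y = c • (v - v') := by
  have hv : v ∈ solutionSet a b := h.extremePoints.1.1
  have hv' : v' ∈ solutionSet a b := h.extremePoints.2.1
  have hw : midpoint ℝ v v' ∈ segment ℝ v v' := midpoint_mem_segment v v'
  have haw : ∀ i, a i (midpoint ℝ v v') = (a i v + a i v') / 2 := fun i => by
    rw [midpoint_eq_smul_add]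
    simp
    ring
  -- Constraints active at the midpoint are active at both ends, so the midpoint can move both ways
  -- along `y`; extremality keeps it on the segment.
  obtain ⟨ε, hε, h1, h2⟩ := exists_add_sub_smul_mem (h.2.2.1 hw) (y := y) fun i hi => by
    rw [haw] at hi
    have := hv i
    have := hv' i
    exact hy i (by linarith) (by linarith)
  have h3 := h.2.2.2 h1 h2 hw (mem_openSegment_add_sub _ _)
  rw [segment_eq_image'] at h3
  obtain ⟨θ, -, e⟩ := h3
  refine ⟨ε⁻¹ * (1 / 2 - θ), ?_⟩
  have e2 : ε • y = (1 / 2 - θ) • (v - v') := by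
    have : ε • y = (v + θ • (v' - v)) - midpoint ℝ v v' := by
      rw [eq_sub_iff_add_eq, add_comm]; exact e.symm
    rw [this, midpoint_eq_smul_add, invOf_eq_inv]
    module
  rw [mul_smul, ← e2, inv_smul_smul₀ hε.ne']

/-- From a vertex that does not maximize `l`, there is an edge along which `l` increases. -/
theorem exists_improving_edge {a : Fin m → Module.Dual ℝ V} {b : Fin m → ℝ}
    (hP : ∀ l : Module.Dual ℝ V, BddAbove (l '' solutionSet a b)) {v x : V}
    (hv : v ∈ vertices a b) (hx : x ∈ solutionSet a b) (l : Module.Dual ℝ V) (hl : l v < l x) :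
    ∃ v', IsEdge (solutionSet a b) v v' ∧ l v < l v' := by
  obtain ⟨hvP, hker⟩ := mem_extremePoints_solutionSet_iff.1 hv
  obtain ⟨r, hr, hlr, hray⟩ := exists_extreme_ray a (s := {i | a i v = b i}) hker l (x := x - v)
    (fun i hi => by rw [map_sub, hi]; exact sub_nonpos.2 (hx i)) (by rw [map_sub]; linarith)
  -- Otherwise the whole ray from `v` along `r` is feasible; the multiple below pushes `l` to `l v +
  -- |M - l v| + 1`, above its bound `M`.
  have hpos : ∃ i ∈ Set.univ, 0 < a i r := by
    by_contra! hcon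
    obtain ⟨M, hM⟩ := hP l
    have := hM (Set.mem_image_of_mem l (x := v + ((|M - l v| + 1) / l r) • r) fun i => by
      have := mul_nonpos_of_nonneg_of_nonpos
        (show 0 ≤ (|M - l v| + 1) / l r by positivity) (hcon i trivial)
      simp only [map_add, map_smul, smul_eq_mul]
      linarith [hvP i])
    simp only [map_add, map_smul, smul_eq_mul] at this
    rw [div_mul_cancel₀ _ hlr.ne'] at this
    linarith [le_abs_self (M - l v)]
  obtain ⟨t, ht, hfeas, i, -, hi, htight⟩ := exists_first_tight a b (fun i _ => hvP i) hpos
  -- The blocking constraint increases along `r`, so it is not active at `v`.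
  have ht0 : 0 < t := by
    refine ht.lt_of_ne fun h => ?_
    subst h
    exact absurd (hr i (by simpa using htight)) (not_le.2 hi)
  have hlv' : l v < l (v + t • r) := by
    simp only [map_add, map_smul, smul_eq_mul]
    have := mul_pos ht0 hlr
    linarith
  have hr0 : r ≠ 0 := fun h => by simp [h] at hlr
  refine ⟨v + t • r, ⟨fun h => hlv'.ne (congrArg l h), convex_segment _ _, ?_⟩, hlv'⟩
  -- These equalities confine points to the line through `v` along `r`. Pointedness at `v` excludes
  -- negative parameters, and the blocking constraint excludes those beyond `t`.
  have hseg : segment ℝ v (v + t • r) =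
      solutionSet a b ∩ hyperplaneInter a {j | a j v = b j ∧ a j r = 0} b := by
    apply Set.Subset.antisymm
    · refine ((convex_solutionSet a b).inter ?_).segment_subset
        ⟨hvP, fun j hj => hj.1⟩ ⟨fun j => hfeas j trivial, fun j hj => by simp [hj.1, hj.2]⟩
      intro p hp q hq α β _ _ hαβ j hj
      simp only [map_add, map_smul, smul_eq_mul, hp j hj, hq j hj]
      rw [← add_mul, hαβ, one_mul]
    · rintro p ⟨hpP, hp⟩
      obtain ⟨c, hc⟩ := hray (p - v) fun j hj hj' => by
        rw [map_sub, hp j ⟨hj, hj'⟩, hj, sub_self]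
      obtain rfl : p = v + c • r := by rw [← hc]; abel
      have hc0 : 0 ≤ c := by
        by_contra! hneg
        refine hr0 (hker r fun j hj => le_antisymm (hr j hj) ?_)
        have := hpP j
        simp only [map_add, map_smul, smul_eq_mul] at this
        rw [hj] at this
        by_contra! hlt
        nlinarith [mul_pos_of_neg_of_neg hneg hlt]
      have hct : c ≤ t := by
        have := hpP i
        rw [← htight] at this
        simp only [map_add, map_smul, smul_eq_mul] at this
        exact le_of_mul_le_mul_right (by linarith) hi
      rw [segment_eq_image']
      refine ⟨c / t, ⟨by positivity, (div_le_one ht0).2 hct⟩, ?_⟩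
      simp [smul_smul, div_mul_cancel₀ _ ht0.ne']
  rw [hseg]
  exact isExtreme_solutionSet_inter a b _

/-- A midpoint of feasible points is strict wherever either point is, so strictness can be gained
one constraint at a time. -/
theorem exists_strict_solution {a : Fin m → Module.Dual ℝ V} {b : Fin m → ℝ}
    (hne : (solutionSet a b).Nonempty) (h : ∀ i, ∃ x ∈ solutionSet a b, a i x < b i) :
    ∃ x, ∀ i, a i x < b i := by
  classical
  suffices H : ∀ s : Finset (Fin m), ∃ x ∈ solutionSet a b, ∀ i ∈ s, a i x < b i by
    obtain ⟨x, -, hx⟩ := H Finset.univ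
    exact ⟨x, fun i => hx i (Finset.mem_univ i)⟩
  intro s
  induction s using Finset.induction_on with
  | empty =>
    obtain ⟨x, hx⟩ := hne
    exact ⟨x, hx, by simp⟩
  | insert j s _ ih =>
    obtain ⟨x, hx, hxs⟩ := ih
    obtain ⟨y, hy, hyj⟩ := h j
    refine ⟨midpoint ℝ x y, (convex_solutionSet a b).midpoint_mem hx hy, fun i hi => ?_⟩
    have haw : a i (midpoint ℝ x y) = (a i x + a i y) / 2 := by
      rw [midpoint_eq_smul_add]
      simp
      ring
    rw [haw]
    rcases Finset.mem_insert.1 hi with rfl | hi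
    · linarith [hx i]
    · linarith [hxs i hi, hy i]

/-- Boundedness of a solution set with a strict solution does not depend on the right-hand side. -/
theorem bddAbove_image_solutionSet {a : Fin m → Module.Dual ℝ V} {b₀ : Fin m → ℝ} {x₀ : V}
    (hx₀ : ∀ i, a i x₀ < b₀ i) {l : Module.Dual ℝ V} (hl : BddAbove (l '' solutionSet a b₀))
    (b : Fin m → ℝ) : BddAbove (l '' solutionSet a b) := by
  obtain ⟨K, hK⟩ := hl
  -- For such `M`, the map `x ↦ x₀ + M⁻¹ • x` sends the second solution set into the first.
  obtain ⟨M, hM0, hM⟩ : ∃ M : ℝ, 0 < M ∧ ∀ i, b i ≤ M * (b₀ i - a i x₀) := by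
    refine (((eventually_gt_atTop (0 : ℝ)).and (eventually_all.2 fun i => ?_))).exists
    filter_upwards [eventually_ge_atTop (b i / (b₀ i - a i x₀))] with M hM
    exact (div_le_iff₀ (sub_pos.2 (hx₀ i))).1 hM
  refine ⟨M * (K - l x₀), ?_⟩
  rintro _ ⟨x, hx, rfl⟩
  have := hK (Set.mem_image_of_mem l (x := x₀ + M⁻¹ • x) fun i => by
    have h1 : a i x ≤ M * (b₀ i - a i x₀) := (hx i).trans (hM i)
    have h2 := (inv_mul_le_iff₀ hM0).2 h1
    simp only [map_add, map_smul, smul_eq_mul]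
    linarith)
  simp only [map_add, map_smul, smul_eq_mul] at this
  exact (inv_mul_le_iff₀ hM0).1 (by linarith)

theorem IsFacetSystem.nonempty {a : Fin m → Module.Dual ℝ V} {b₀ : Fin m → ℝ}
    (h : IsFacetSystem a b₀) : (solutionSet a b₀).Nonempty := by
  by_contra! he
  have := h.fullDimensional
  rw [he, AffineSubspace.span_empty] at this
  exact AffineSubspace.bot_ne_top ℝ V V this

theorem IsFacetSystem.exists_strict_solution {a : Fin m → Module.Dual ℝ V} {b₀ : Fin m → ℝ}
    (h : IsFacetSystem a b₀) : ∃ x, ∀ i, a i x < b₀ i := by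
  refine PolytopeDeformation.exists_strict_solution h.nonempty fun i => ?_
  by_contra! hcon
  -- A facet equal to the full-dimensional polytope would have the wrong dimension.
  have he : facet a b₀ i = solutionSet a b₀ :=
    Set.Subset.antisymm (fun x hx => hx.1) fun x hx => ⟨hx, le_antisymm (hx i) (hcon x hx)⟩
  have := (h.isFacet i).2.2
  rw [he, ← direction_affineSpan, h.fullDimensional, AffineSubspace.direction_top,
    finrank_top] at this
  omega

end Polyhedra

/-! ### Selections of independent facets and the linear map `b ↦ v_b`. -/

section Selections

/-- Greedily keeping the vectors that are not in the span of their predecessors yields a linearly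
independent family. -/
theorem linearIndepOn_greedy {M : Type*} [AddCommGroup M] [Module ℝ M] {m : ℕ} (f : Fin m → M)
    (T : Set (Fin m)) :
    LinearIndepOn ℝ f {i | i ∈ T ∧ f i ∉ Submodule.span ℝ (f '' {j | j ∈ T ∧ j < i})} := by
  set G := {i | i ∈ T ∧ f i ∉ Submodule.span ℝ (f '' {j | j ∈ T ∧ j < i})} with hG
  suffices H : ∀ n : ℕ, LinearIndepOn ℝ f {i | i ∈ G ∧ (i : ℕ) < n} by
    refine (H m).mono fun i hi => ⟨hi, i.2⟩
  intro n
  induction n with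
  | zero => simp
  | succ n ih =>
    by_cases hn : ∃ i ∈ G, (i : ℕ) = n
    · obtain ⟨i, hi, rfl⟩ := hn
      have : {j | j ∈ G ∧ (j : ℕ) < i + 1} = insert i {j | j ∈ G ∧ (j : ℕ) < i} := by
        ext j
        simp only [Set.mem_ofPred_eq, Set.mem_insert_iff]
        constructor
        · rintro ⟨h1, h2⟩
          rcases (Nat.lt_succ_iff.1 h2).eq_or_lt with h | h
          · exact Or.inl (Fin.ext h)
          · exact Or.inr ⟨h1, h⟩
        · rintro (rfl | ⟨h1, h2⟩)
          · exact ⟨hi, Nat.lt_succ_self _⟩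
          · exact ⟨h1, h2.trans (Nat.lt_succ_self _)⟩
      rw [this]
      have hsub : {j | j ∈ G ∧ (j : ℕ) < i} ⊆ {j | j ∈ T ∧ j < i} :=
        fun j hj => ⟨hj.1.1, hj.2⟩
      exact ih.insert fun hmem => hi.2 (Submodule.span_mono (Set.image_mono hsub) hmem)
    · push Not at hn
      exact ih.mono fun j hj => ⟨hj.1, by have := hn j hj.1; have := hj.2; omega⟩

theorem span_greedy {M : Type*} [AddCommGroup M] [Module ℝ M] {m : ℕ} (f : Fin m → M)
    (T : Set (Fin m)) :
    Submodule.span ℝ (f '' T) ≤ Submodule.span ℝ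
      (f '' {i | i ∈ T ∧ f i ∉ Submodule.span ℝ (f '' {j | j ∈ T ∧ j < i})}) := by
  rw [Submodule.span_le]
  rintro _ ⟨i, hi, rfl⟩
  induction i using WellFoundedLT.induction with
  | _ i ih =>
  by_cases h : f i ∈ Submodule.span ℝ (f '' {j | j ∈ T ∧ j < i})
  · refine Submodule.span_le.2 ?_ h
    rintro _ ⟨j, hj, rfl⟩
    exact ih j hj.2 hj.1
  · exact Submodule.subset_span ⟨i, ⟨hi, h⟩, rfl⟩

variable {V : Type*} [AddCommGroup V] [Module ℝ V] [FiniteDimensional ℝ V] {m : ℕ}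

/-- Turns the kernel criterion for vertices into spanning of the dual; with the greedy choice this
yields exactly `d` selected facets. -/
theorem span_eq_top_of_forall_eq_zero {S : Set (Module.Dual ℝ V)}
    (h : ∀ x, (∀ f ∈ S, f x = 0) → x = 0) : Submodule.span ℝ S = ⊤ := by
  have h0 : (Submodule.span ℝ S).dualCoannihilator = ⊥ := by
    rw [eq_bot_iff]
    intro x hx
    rw [Submodule.mem_dualCoannihilator] at hx
    exact h x fun f hf => hx f (Submodule.subset_span hf)
  rw [← Subspace.dualCoannihilator_dualAnnihilator_eq (W := Submodule.span ℝ S), h0,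
    Submodule.dualAnnihilator_bot]

theorem isSelection_firstSupporting (a : Fin m → Module.Dual ℝ V) (b₀ : Fin m → ℝ) :
    IsSelection a b₀ (firstSupporting a b₀) := by
  classical
  intro v hv
  have hli : LinearIndependent ℝ (fun i : firstSupporting a b₀ v => a i) :=
    linearIndepOn_greedy a (supporting a b₀ v)
  refine ⟨fun i hi => hi.1, ?_, hli⟩
  obtain ⟨hvP, hker⟩ := mem_extremePoints_solutionSet_iff.1 hv
  have hspan : Submodule.span ℝ (a '' firstSupporting a b₀ v) = ⊤ := by
    refine top_le_iff.1 (le_trans (top_le_iff.2 ?_) (span_greedy a (supporting a b₀ v)))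
    refine span_eq_top_of_forall_eq_zero fun x hx => hker x fun i hi => ?_
    exact hx _ ⟨i, (mem_supporting_iff hvP).2 hi, rfl⟩
  have hspan' : ⊤ ≤ Submodule.span ℝ (Set.range fun i : firstSupporting a b₀ v => a i) := by
    rw [← hspan, Set.image_eq_range]
  rw [← Subspace.dual_finrank_eq, Module.finrank_eq_nat_card_basis (Module.Basis.mk hli hspan')]
  rfl

/-- The selected normals form a basis of the dual, so evaluating them is a linear isomorphism from
`V` to `s → ℝ`; its inverse gives `L`. -/
theorem exists_linear_hyperplaneInter (a : Fin m → Module.Dual ℝ V) {s : Set (Fin m)}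
    (hcard : s.ncard = Module.finrank ℝ V) (hli : LinearIndependent ℝ (fun i : s => a i)) :
    ∃ L : (Fin m → ℝ) →ₗ[ℝ] V, ∀ b, hyperplaneInter a s b = {L b} := by
  classical
  let T : V →ₗ[ℝ] (s → ℝ) := LinearMap.pi fun i => a i
  have hc : Fintype.card s = Module.finrank ℝ V := by
    rw [← hcard, Set.ncard_eq_toFinset_card', Set.toFinset_card]
  have hspan : Submodule.span ℝ (Set.range fun i : s => a i) = ⊤ :=
    hli.span_eq_top_of_card_eq_finrank' (by rw [hc, Subspace.dual_finrank_eq])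
  have hT : Function.Injective T := by
    rw [← LinearMap.ker_eq_bot, eq_bot_iff]
    intro x hx
    rw [Submodule.mem_bot, ← Module.forall_dual_apply_eq_zero_iff ℝ]
    intro f
    have hf : f ∈ Submodule.span ℝ (Set.range fun i : s => a i) := by rw [hspan]; trivial
    induction hf using Submodule.span_induction with
    | mem f hf =>
      obtain ⟨i, rfl⟩ := hf
      exact congrFun (LinearMap.mem_ker.1 hx) i
    | zero => rfl
    | add f g _ _ hf hg => rw [LinearMap.add_apply, hf, hg, add_zero]
    | smul c f _ hf => rw [LinearMap.smul_apply, hf, smul_zero]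
  let e := LinearMap.linearEquivOfInjective T hT (by rw [Module.finrank_pi, hc])
  refine ⟨e.symm.toLinearMap ∘ₗ LinearMap.funLeft ℝ ℝ Subtype.val, fun b => ?_⟩
  ext x
  rw [Set.mem_singleton_iff, LinearMap.comp_apply, LinearEquiv.coe_coe, LinearEquiv.eq_symm_apply]
  constructor
  · intro hx
    ext i
    exact hx i i.2
  · intro h i hi
    exact congrFun h ⟨i, hi⟩

theorem exists_linear_meetingPoint (a : Fin m → Module.Dual ℝ V) {s : Set (Fin m)}
    (hcard : s.ncard = Module.finrank ℝ V) (hli : LinearIndependent ℝ (fun i : s => a i)) :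
    ∃ L : (Fin m → ℝ) →ₗ[ℝ] V, ∀ b,
      hyperplaneInter a s b = {meetingPoint a s b} ∧ meetingPoint a s b = L b := by
  obtain ⟨L, hL⟩ := exists_linear_hyperplaneInter a hcard hli
  have key : ∀ b, meetingPoint a s b = L b := fun b => by
    have h : (hyperplaneInter a s b).Nonempty := by rw [hL]; exact Set.singleton_nonempty _
    rw [meetingPoint, dif_pos h]
    exact (hL b).le h.choose_spec
  exact ⟨L, fun b => ⟨by rw [key, hL], key b⟩⟩

end Selections

/-! ### The equivalent descriptions of the deformation cone. -/

section DeformationCone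

variable {V : Type*} [AddCommGroup V] [Module ℝ V] [FiniteDimensional ℝ V] {m : ℕ}
  {a : Fin m → Module.Dual ℝ V} {b₀ : Fin m → ℝ} {σ : V → Set (Fin m)}

theorem IsSelection.hyperplaneInter_eq (hσ : IsSelection a b₀ σ) {v : V} (hv : v ∈ vertices a b₀)
    (b : Fin m → ℝ) : hyperplaneInter a (σ v) b = {meetingPoint a (σ v) b} := by
  obtain ⟨L, hL⟩ := exists_linear_meetingPoint a (hσ v hv).2.1 (hσ v hv).2.2
  exact (hL b).1

theorem IsSelection.apply_meetingPoint (hσ : IsSelection a b₀ σ) {b : Fin m → ℝ}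
    (hE : ExtraEqualities a b₀ σ b) {v : V} (hv : v ∈ vertices a b₀) {i : Fin m}
    (hi : i ∈ supporting a b₀ v) : a i (meetingPoint a (σ v) b) = b i := by
  by_cases h : i ∈ σ v
  · have : meetingPoint a (σ v) b ∈ hyperplaneInter a (σ v) b := by
      rw [hσ.hyperplaneInter_eq hv]; rfl
    exact this i h
  · exact hE v hv i hi h

theorem IsSelection.hyperplaneInter_supporting (hσ : IsSelection a b₀ σ) {b : Fin m → ℝ}
    (hE : ExtraEqualities a b₀ σ b) {v : V} (hv : v ∈ vertices a b₀) :
    hyperplaneInter a (supporting a b₀ v) b = {meetingPoint a (σ v) b} := by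
  refine Set.Subset.antisymm ?_ ?_
  · rw [← hσ.hyperplaneInter_eq hv]
    exact fun x hx i hi => hx i ((hσ v hv).1 hi)
  · rintro _ rfl i hi
    exact hσ.apply_meetingPoint hE hv hi

theorem mem_deformationCone_iff (hP₀ : IsFacetSystem a b₀) (hσ : IsSelection a b₀ σ)
    (b : Fin m → ℝ) :
    b ∈ deformationCone a b₀ ↔ ExtraEqualities a b₀ σ b ∧
      ∀ v ∈ vertices a b₀, ∀ i, i ∉ supporting a b₀ v → IneqCond a σ b v i := by
  constructor
  · rintro ⟨Q, -, rfl, h⟩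
    have key : ∀ v ∈ vertices a b₀, meetingPoint a (σ v) b ∈ solutionSet a b ∧
        meetingPoint a (σ v) b ∈ hyperplaneInter a (supporting a b₀ v) b := by
      intro v hv
      obtain ⟨u, hu, hu'⟩ := h v hv
      have hmem : u ∈ hyperplaneInter a (supporting a b₀ v) b := by rw [hu']; rfl
      have : u ∈ hyperplaneInter a (σ v) b := fun i hi => hmem i ((hσ v hv).1 hi)
      rw [hσ.hyperplaneInter_eq hv, Set.mem_singleton_iff] at this
      rw [← this]
      exact ⟨hu.1, hmem⟩
    exact ⟨fun v hv i hi _ => (key v hv).2 i hi, fun v hv i _ => (key v hv).1 i⟩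
  · rintro ⟨hE, hI⟩
    obtain ⟨x₀, hx₀⟩ := hP₀.exists_strict_solution
    refine ⟨solutionSet a b, ⟨⟨m, a, b, rfl⟩, fun l =>
      bddAbove_image_solutionSet hx₀ (hP₀.isPolytope.2 l) b⟩, rfl, fun v hv =>
      ⟨meetingPoint a (σ v) b, ?_, hσ.hyperplaneInter_supporting hE hv⟩⟩
    refine mem_extremePoints_solutionSet_iff.2 ⟨fun i => ?_, fun y hy => ?_⟩
    · by_cases hi : i ∈ supporting a b₀ v
      · exact (hσ.apply_meetingPoint hE hv hi).le
      · exact hI v hv i hi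
    · obtain ⟨hvP, hker⟩ := mem_extremePoints_solutionSet_iff.1 hv
      exact hker y fun i hi =>
        hy i (hσ.apply_meetingPoint hE hv ((mem_supporting_iff hvP).2 hi))

theorem exists_edge_length_of_neighbor (hσ : IsSelection a b₀ σ) {b : Fin m → ℝ}
    (hE : ExtraEqualities a b₀ σ b)
    (hI : ∀ v ∈ vertices a b₀, ∀ i, IsNeighbor a b₀ v i → IneqCond a σ b v i) {v v' : V}
    (h : IsEdge (solutionSet a b₀) v v') :
    ∃ t : ℝ, 0 ≤ t ∧ meetingPoint a (σ v) b - meetingPoint a (σ v') b = t • (v - v') := by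
  obtain ⟨hv, hv'⟩ := h.extremePoints
  obtain ⟨t, ht⟩ := h.exists_eq_smul
    (y := meetingPoint a (σ v) b - meetingPoint a (σ v') b) fun i hi hi' => by
      rw [map_sub, hσ.apply_meetingPoint hE hv ⟨hv.1, hi⟩,
        hσ.apply_meetingPoint hE hv' ⟨hv'.1, hi'⟩, sub_self]
  refine ⟨t, ?_, ht⟩
  -- This facet neighbors `v`. Its normal is negative on `v - v'` and nonpositive on `v_b - v'_b`,
  -- so the factor `t` cannot be negative.
  obtain ⟨i, hi', hi⟩ : ∃ i ∈ supporting a b₀ v', i ∉ supporting a b₀ v := by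
    by_contra! hcon
    exact h.1 (eq_of_supporting_subset hv' hcon)
  have hle : a i (meetingPoint a (σ v) b) ≤ b i := hI v hv i ⟨hi, v', hi', h⟩
  have heq := hσ.apply_meetingPoint hE hv' hi'
  have hlt : a i v < b₀ i := (hv.1 i).lt_of_ne fun e => hi ⟨hv.1, e⟩
  have := congrArg (a i) ht
  rw [map_sub, map_smul, map_sub, heq, hi'.2, smul_eq_mul] at this
  by_contra! hneg
  nlinarith [mul_pos_of_neg_of_neg hneg (sub_neg.2 hlt)]

/-- Ascending along edges to the facet `Fᵢ` shows that the edge condition implies all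
inequalities. -/
theorem ineqCond_of_edge_lengths (hP₀ : IsFacetSystem a b₀) (hσ : IsSelection a b₀ σ)
    {b : Fin m → ℝ} (hE : ExtraEqualities a b₀ σ b)
    (hedge : ∀ v v' : V, IsEdge (solutionSet a b₀) v v' →
      ∃ t : ℝ, 0 ≤ t ∧ meetingPoint a (σ v) b - meetingPoint a (σ v') b = t • (v - v'))
    {v : V} (hv : v ∈ vertices a b₀) (i : Fin m) : IneqCond a σ b v i := by
  by_contra hbad
  obtain ⟨w, ⟨hw, hwbad⟩, hmax⟩ := Set.exists_max_image
    {w | w ∈ vertices a b₀ ∧ ¬ IneqCond a σ b w i} (fun w => a i w)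
    ((finite_vertices a b₀).subset fun w hw => hw.1) ⟨v, hv, hbad⟩
  have hlt : a i w < b₀ i := (hw.1 i).lt_of_ne fun e =>
    hwbad (hσ.apply_meetingPoint hE hw ⟨hw.1, e⟩).le
  obtain ⟨x, hx⟩ := (hP₀.isFacet i).2.1
  obtain ⟨w', he, hlt'⟩ := exists_improving_edge hP₀.isPolytope.2 hw hx.1 (a i)
    (by rw [hx.2]; exact hlt)
  obtain ⟨t, ht, e⟩ := hedge w w' he
  have hle : a i (meetingPoint a (σ w') b) ≤ b i := by
    by_contra hcon
    exact absurd (hmax w' ⟨he.extremePoints.2, hcon⟩) (not_le.2 hlt')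
  refine hwbad (?_ : a i (meetingPoint a (σ w) b) ≤ b i)
  have := congrArg (a i) e
  rw [map_sub, map_smul, map_sub, smul_eq_mul] at this
  have := mul_nonpos_of_nonneg_of_nonpos ht (sub_neg.2 hlt').le
  linarith

theorem exists_dualFG_eq_deformationCone (hP₀ : IsFacetSystem a b₀) :
    ∃ C : PointedCone ℝ (Fin m → ℝ),
      C.DualFG (LinearMap.id : Module.Dual ℝ (Fin m → ℝ) →ₗ[ℝ] Module.Dual ℝ (Fin m → ℝ)) ∧
        (C : Set (Fin m → ℝ)) = deformationCone a b₀ := by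
  have hσ := isSelection_firstSupporting a b₀
  set σ := firstSupporting a b₀
  choose! L hL using fun v (hv : v ∈ vertices a b₀) =>
    exists_linear_meetingPoint a (hσ v hv).2.1 (hσ v hv).2.2
  let φ : V × Fin m → Module.Dual ℝ (Fin m → ℝ) := fun p =>
    LinearMap.proj p.2 - a p.2 ∘ₗ L p.1
  have hφ : ∀ v ∈ vertices a b₀, ∀ i b, φ (v, i) b = b i - a i (meetingPoint a (σ v) b) :=
    fun v hv i b => by simp [φ, (hL v hv b).2]
  have hfin : (vertices a b₀ ×ˢ (Set.univ : Set (Fin m))).Finite :=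
    (finite_vertices a b₀).prod Set.finite_univ
  -- One inequality for every vertex and facet, and the reverse one for incident pairs, which makes
  -- those equalities. Including selected facets is harmless, as their equalities always hold.
  refine ⟨PointedCone.dual LinearMap.id (φ '' (vertices a b₀ ×ˢ Set.univ) ∪
    (fun p => -φ p) '' {p ∈ vertices a b₀ ×ˢ Set.univ | p.2 ∈ supporting a b₀ p.1}),
    PointedCone.DualFG.dual_of_finite _
      ((hfin.image _).union ((hfin.subset (Set.sep_subset _ _)).image _)), ?_⟩
  ext b
  rw [SetLike.mem_coe, PointedCone.mem_dual, mem_deformationCone_iff hP₀ hσ]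
  constructor
  · intro h
    have h1 : ∀ v ∈ vertices a b₀, ∀ i, a i (meetingPoint a (σ v) b) ≤ b i := fun v hv i => by
      have := h (Or.inl ⟨(v, i), ⟨hv, trivial⟩, rfl⟩)
      rw [LinearMap.id_apply, hφ v hv] at this
      linarith
    refine ⟨fun v hv i hi _ => le_antisymm (h1 v hv i) ?_, fun v hv i _ => h1 v hv i⟩
    have := h (Or.inr ⟨(v, i), ⟨⟨hv, trivial⟩, hi⟩, rfl⟩)
    rw [LinearMap.id_apply, LinearMap.neg_apply, hφ v hv] at this
    linarith
  · rintro ⟨hE, hI⟩ _ (⟨⟨v, i⟩, ⟨hv, -⟩, rfl⟩ | ⟨⟨v, i⟩, ⟨⟨hv, -⟩, hi⟩, rfl⟩)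
    · rw [LinearMap.id_apply, hφ v hv, sub_nonneg]
      by_cases hi : i ∈ supporting a b₀ v
      · exact (hσ.apply_meetingPoint hE hv hi).le
      · exact hI v hv i hi
    · rw [LinearMap.id_apply, LinearMap.neg_apply, hφ v hv, hσ.apply_meetingPoint hE hv hi,
        sub_self, neg_zero]

end DeformationCone

end PolytopeDeformation

theorem proposition2p8 {V : Type*} [AddCommGroup V] [Module ℝ V] [FiniteDimensional ℝ V] {m : ℕ}
    (a : Fin m → Module.Dual ℝ V) (b₀ : Fin m → ℝ) (hP₀ : IsFacetSystem a b₀) :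
    -- the first `d` independent supporting facets form a selection
    IsSelection a b₀ (firstSupporting a b₀) ∧
    (∀ σ : V → Set (Fin m), IsSelection a b₀ σ →
      -- `v_b` is the only point on the selected hyperplanes, and it depends linearly on `b`
      (∀ v ∈ vertices a b₀, ∃ L : (Fin m → ℝ) →ₗ[ℝ] V, ∀ b : Fin m → ℝ,
        hyperplaneInter a (σ v) b = {meetingPoint a (σ v) b} ∧ meetingPoint a (σ v) b = L b) ∧
      ∀ b : Fin m → ℝ, List.TFAE [
        b ∈ deformationCone a b₀,
        ExtraEqualities a b₀ σ b ∧
          ∀ v ∈ vertices a b₀, ∀ i, i ∉ supporting a b₀ v → IneqCond a σ b v i,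
        ExtraEqualities a b₀ σ b ∧
          ∀ v ∈ vertices a b₀, ∀ i, IsNeighbor a b₀ v i → IneqCond a σ b v i,
        ExtraEqualities a b₀ σ b ∧
          ∀ v v' : V, IsEdge (solutionSet a b₀) v v' →
            ∃ t : ℝ, 0 ≤ t ∧
              meetingPoint a (σ v) b - meetingPoint a (σ v') b = t • (v - v')]) ∧
    -- the deformation cone is a polyhedral cone: finitely many homogeneous linear inequalities
    ∃ C : PointedCone ℝ (Fin m → ℝ),
      C.DualFG (LinearMap.id : Module.Dual ℝ (Fin m → ℝ) →ₗ[ℝ] Module.Dual ℝ (Fin m → ℝ)) ∧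
        (C : Set (Fin m → ℝ)) = deformationCone a b₀ := by
  refine ⟨isSelection_firstSupporting a b₀, fun σ hσ => ⟨fun v hv =>
    exists_linear_meetingPoint a (hσ v hv).2.1 (hσ v hv).2.2, fun b => ?_⟩,
    exists_dualFG_eq_deformationCone hP₀⟩
  tfae_have 1 ↔ 2 := mem_deformationCone_iff hP₀ hσ b
  tfae_have 2 → 3 := fun h => ⟨h.1, fun v hv i hi => h.2 v hv i hi.1⟩
  tfae_have 3 → 4 := fun h => ⟨h.1, fun _ _ he => exists_edge_length_of_neighbor hσ h.1 h.2 he⟩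
  tfae_have 4 → 2 := fun h => ⟨h.1, fun _ hv i _ => ineqCond_of_edge_lengths hP₀ hσ h.1 h.2 hv i⟩
  tfae_finish
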